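/- **Theorem 3.1.** For a finite connected graph $G$ let $\mathrm{Gut}(G)=\frac12\sum_{u\in V_G}\sum_{v\in V_G}\deg(u)\deg(v)\,\mathrm{dis}_G(u,v)$ be its Gutman index. A cyclooctane chain $COC_n$ consists of $n$ octagons ($8$-cycles) $O_1,\dots,O_n$, where the vertices of each octagon are labelled cyclically $x_1,\dots,x_8$ and, for $1\le k<n$, one edge joins a vertex $u_k$ of $O_k$ to the vertex $x_1$ of $O_{k+1}$; for $k\ge 2$ the vertex $u_k$ is not the vertex $x_1$ of $O_k$. For $k\ge2$ and $i=1,2,3,4$, let $Z_k^i$ be $1$ if $O_{k+1}$ is attached to $COC_k$ in the $i$-th way and $0$ otherwise, where the ways $1,2,3,4$ mean that $u_k$ is, respectively, $x_2$ or $x_8$; $x_3$ or $x_7$; $x_4$ or $x_6$; $x_5$ (in $O_k$). In the random chain the $Z_k^i$ are random variables. Suppose that 1. the random vectors $(Z_k^1,Z_k^2,Z_k^3,Z_k^4)$, $k\ge2$, are independent, and $\mathbb P(Z_k^i=1)=p_i$, $\mathbb P(Z_k^i=0)=1-p_i$ for all $k\ge 2$ and $i=1,2,3,4$, where $p_4=1-p_1-p_2-p_3$;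 2. $0<p_i<1$ for $i=1,2,3,4$. Put $$\begin{aligned} \sigma_1^2&=648^2p_1+972^2p_2+1296^2p_3+1620^2p_4-(648p_1+972p_2+1296p_3+1620p_4)^2,\\ \tilde\sigma_1^2&=90^2p_1+414^2p_2+738^2p_3+1062^2p_4-(90p_1+414p_2+738p_3+1062p_4)^2,\\ r_1&=648\cdot90\,p_1+972\cdot414\,p_2+1296\cdot738\,p_3+1620\cdot1062\,p_4\\ &\quad-(648p_1+972p_2+1296p_3+1620p_4)(90p_1+414p_2+738p_3+1062p_4). \end{aligned}$$ For every $k\ge2$ these are $\sigma_1^2=\mathrm{Var}(U_k)$, $\tilde\sigma_1^2=\mathrm{Var}(V_k)$ and $r_1=\mathrm{Cov}(U_k,V_k)$, where $U_k=648Z_k^1+972Z_k^2+1296Z_k^3+1620Z_k^4$ and $V_k=90Z_k^1+414Z_k^2+738Z_k^3+1062Z_k^4$. Moreover: (i) For every $n\ge1$, $\mathrm{Gut}(COC_n)$ is a square-integrable random variable and $$\begin{aligned}\mathrm{Var}\big(\mathrm{Gut}(COC_n)\big)=\frac1{30}\Big(&\sigma_1^2n^5-5r_1n^4+10\tilde\sigma_1^2n^3+(65r_1-30\sigma_1^2-45\tilde\sigma_1^2)n^2\\&+(59\sigma_1^2+65\tilde\sigma_1^2-120r_1)n+(60r_1-30\sigma_1^2-30\tilde\sigma_1^2)\Big).\end{aligned}$$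 (ii) $\mathrm{Gut}(COC_n)$ is asymptotically normal: $$\lim_{n\to\infty}\sup_{a\in\mathbb R}\left|\mathbb P\left(\frac{\mathrm{Gut}(COC_n)-\mathbb E(\mathrm{Gut}(COC_n))}{\sqrt{\mathrm{Var}(\mathrm{Gut}(COC_n))}}\le a\right)-\int_{-\infty}^a\frac1{\sqrt{2\pi}}e^{-t^2/2}\,dt\right|=0.$$ -/

import Mathlib

open MeasureTheory ProbabilityTheory Filter Topology

open Classical in
/-- The Gutman index `(1/2) ∑_u ∑_v deg(u) deg(v) dis(u, v)` of a finite graph. -/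
noncomputable def gutmanIndex {V : Type*} [Fintype V] (G : SimpleGraph V) : ℝ :=
  (1 / 2) * ∑ a : V, ∑ b : V, (G.degree a : ℝ) * (G.degree b : ℝ) * (G.dist a b : ℝ)

/-- The cyclooctane chain with octagons `O_1, …, O_n`, described by the attaching vertices
`u 1, u 2, …`. The vertex `(k, j)` is the vertex `x_{j+1}` of `O_{k+1}` (the vertices `x_1, …, x_8`
of an octagon being labelled cyclically), and for `1 ≤ k < n` one edge joins the vertex labelled
`u k` of `O_k` to the vertex `x_1` of `O_{k+1}`. -/
def cocGraph (n : ℕ) (u : ℕ → Fin 8) : SimpleGraph (Fin n × Fin 8) where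
  Adj a b :=
    (a.1 = b.1 ∧ (SimpleGraph.cycleGraph 8).Adj a.2 b.2) ∨
    (a.1.val + 1 = b.1.val ∧ a.2 = u (a.1.val + 1) ∧ b.2 = 0) ∨
    (b.1.val + 1 = a.1.val ∧ b.2 = u (b.1.val + 1) ∧ a.2 = 0)
  symm := ⟨by
    rintro a b (⟨h1, h2⟩ | h | h)
    · exact Or.inl ⟨h1.symm, h2.symm⟩
    · exact Or.inr (Or.inr h)
    · exact Or.inr (Or.inl h)⟩
  loopless := ⟨by
    rintro a (⟨_, h⟩ | ⟨h, _⟩ | ⟨h, _⟩)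
    · exact (SimpleGraph.cycleGraph 8).loopless.irrefl _ h
    · omega
    · omega⟩

/-- The labels of the vertices of the last octagon used by the four ways of attaching a new
octagon (in this order: `x_2` or `x_8`, `x_3` or `x_7`, `x_4` or `x_6`, `x_5`).
The label `j` stands for `x_{j+1}`, and the index `i : Fin 4` for the way number `i + 1`. -/
def attachSet : Fin 4 → Finset (Fin 8) := ![{1, 7}, {2, 6}, {3, 5}, {4}]

/-- The indicator variable that is `1` when the octagon `O_{k+1}` is attached
to the chain of `k` octagons in the way number `i + 1`, and `0` otherwise. -/
def choiceZ {Ω : Type*} (u : ℕ → Ω → Fin 8) (k : ℕ) (i : Fin 4) (ω : Ω) : ℝ :=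
  if u k ω ∈ attachSet i then 1 else 0

/-- The Gutman index of the random cyclooctane chain with `n` octagons. -/
noncomputable def gutCOC {Ω : Type*} (u : ℕ → Ω → Fin 8) (n : ℕ) (ω : Ω) : ℝ :=
  gutmanIndex (cocGraph n (fun k => u k ω))

/-- `U_k = 648 Z_k^1 + 972 Z_k^2 + 1296 Z_k^3 + 1620 Z_k^4`. -/
def combU {Ω : Type*} (u : ℕ → Ω → Fin 8) (k : ℕ) (ω : Ω) : ℝ :=
  648 * choiceZ u k 0 ω + 972 * choiceZ u k 1 ω + 1296 * choiceZ u k 2 ω + 1620 * choiceZ u k 3 ω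

/-- `V_k = 90 Z_k^1 + 414 Z_k^2 + 738 Z_k^3 + 1062 Z_k^4`. -/
def combV {Ω : Type*} (u : ℕ → Ω → Fin 8) (k : ℕ) (ω : Ω) : ℝ :=
  90 * choiceZ u k 0 ω + 414 * choiceZ u k 1 ω + 738 * choiceZ u k 2 ω + 1062 * choiceZ u k 3 ω

/-- The constant `σ₁²`. -/
def sigmaSq (p₁ p₂ p₃ : ℝ) : ℝ :=
  648 ^ 2 * p₁ + 972 ^ 2 * p₂ + 1296 ^ 2 * p₃ + 1620 ^ 2 * (1 - p₁ - p₂ - p₃)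
    - (648 * p₁ + 972 * p₂ + 1296 * p₃ + 1620 * (1 - p₁ - p₂ - p₃)) ^ 2

/-- The constant `σ̃₁²`. -/
def sigmaTildeSq (p₁ p₂ p₃ : ℝ) : ℝ :=
  90 ^ 2 * p₁ + 414 ^ 2 * p₂ + 738 ^ 2 * p₃ + 1062 ^ 2 * (1 - p₁ - p₂ - p₃)
    - (90 * p₁ + 414 * p₂ + 738 * p₃ + 1062 * (1 - p₁ - p₂ - p₃)) ^ 2

/-- The constant `r₁`. -/
def covR (p₁ p₂ p₃ : ℝ) : ℝ :=
  -((648 * p₁ + 972 * p₂ + 1296 * p₃ + 1620 * (1 - p₁ - p₂ - p₃))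
      * (90 * p₁ + 414 * p₂ + 738 * p₃ + 1062 * (1 - p₁ - p₂ - p₃)))
    + (648 * 90 * p₁ + 972 * 414 * p₂ + 1296 * 738 * p₃ + 1620 * 1062 * (1 - p₁ - p₂ - p₃))

/-! The Gutman index of a chain is an affine function of the octagon distances `d_k = octDist 0 (u
k)`. A shortest path between different octagons must use all bridges between them, so its length is
a sum of distances inside octagons plus the number of bridges. The distances from a vertex to its
octagon sum to 16 whichever vertex it is, so `u k` matters only through paths that cross its octagon
from `x_1` to `u k`. Counting half-edges on both sides gives (`CocGraph.gutmanIndex_eq`) `Gut =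
const(n) + 324 ∑ k (n - 1 - k) d_{k+1}`; the weight vanishes for the first and the last octagon, so
only the random choices with index at least 2 remain.

The ways 1, 2, 3, 4 are the distances 1, 2, 3, 4, hence `U_k` and `V_k` are `324 d_k` up to additive
constants. The three constants `σ₁²`, `σ̃₁²`, `r₁` therefore all equal `324² v` with `v = Var d_k`,
and the variance follows from independence and `∑ k² (N - k)² = (N⁵ - N) / 30` with `N = n - 1`.

The weights are of order at most `N²` and the standard deviation is of order `N^(5/2)`, so the
normalized weights tend to zero uniformly. A third-order estimate of characteristic functions gives
pointwise convergence to the Gaussian one (`tendsto_charFun_weighted_sum`). Lévy's continuity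
theorem makes this weak convergence, and Pólya's theorem (`tendsto_iSup_abs_sub_of_monotone`) makes
the convergence of distribution functions uniform. -/

/-! ### Distances in the chain. -/

/-- The distance in the cycle on eight vertices. -/
def octDist (a b : Fin 8) : ℕ := min (a - b).val (b - a).val

lemma octDist_self (a : Fin 8) : octDist a a = 0 := by
  revert a; decide

lemma octDist_comm (a b : Fin 8) : octDist a b = octDist b a := by
  revert a b; decide

lemma octDist_le_succ_of_adj {b c : Fin 8} (h : (SimpleGraph.cycleGraph 8).Adj b c) (a : Fin 8) :
    octDist a c ≤ octDist a b + 1 := by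
  revert a b c; decide

lemma exists_adj_octDist_eq {a b : Fin 8} (h : a ≠ b) :
    ∃ c, (SimpleGraph.cycleGraph 8).Adj a c ∧ octDist a b = octDist c b + 1 := by
  revert a b; decide

lemma sum_octDist (a : Fin 8) : ∑ b, octDist a b = 16 := by
  revert a; decide

lemma sum_cycleGraph_adj (a : Fin 8) :
    ∑ b, (if (SimpleGraph.cycleGraph 8).Adj a b then 1 else 0) = 2 := by
  revert a; decide

namespace CocGraph

variable {n : ℕ} {u : ℕ → Fin 8}

lemma exists_walk_octagon (k : Fin n) (a b : Fin 8) :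
    ∃ w : (cocGraph n u).Walk (k, a) (k, b), w.length = octDist a b := by
  induction hd : octDist a b generalizing a with
  | zero =>
    have : a = b := by revert a b; decide
    subst this
    exact ⟨.nil, rfl⟩
  | succ d ih =>
    have hab : a ≠ b := by
      rintro rfl
      simp [octDist_self] at hd
    obtain ⟨c, hc, hc'⟩ := exists_adj_octDist_eq hab
    obtain ⟨w, hw⟩ := ih c (by omega)
    have hadj : (cocGraph n u).Adj (k, a) (k, c) := Or.inl ⟨rfl, hc⟩
    exact ⟨.cons hadj w, by simp [hw]⟩

/-- The length of a shortest path from the vertex `x_1` of octagon `0` to the vertex `x_1` of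
octagon `k`, if the attaching vertices are `u 1, u 2, …`. -/
def position (u : ℕ → Fin 8) (k : ℕ) : ℕ := ∑ l ∈ Finset.range k, (octDist 0 (u (l + 1)) + 1)

lemma position_succ (k : ℕ) :
    position u (k + 1) = position u k + (octDist 0 (u (k + 1)) + 1) :=
  Finset.sum_range_succ _ _

lemma position_mono : Monotone (position u) :=
  monotone_nat_of_le_succ fun k => by rw [position_succ]; omega

/-- The upper bound for distances between different octagons: go to the attaching vertex, then cross
one bridge and one octagon at a time. `position u (i + 1)` stands on the left to avoid truncated
subtraction. -/
lemma exists_walk_of_lt (i : Fin n) (a : Fin 8) (m : ℕ) (hm : i.val + 1 + m < n) (b : Fin 8) :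
    ∃ w : (cocGraph n u).Walk (i, a) (⟨i.val + 1 + m, hm⟩, b),
      w.length + position u (i + 1) =
        octDist a (u (i + 1)) + 1 + position u (i + 1 + m) + octDist 0 b := by
  induction m generalizing b with
  | zero =>
    obtain ⟨w, hw⟩ := exists_walk_octagon (u := u) i a (u (i + 1))
    obtain ⟨w', hw'⟩ := exists_walk_octagon (u := u) ⟨i.val + 1 + 0, hm⟩ 0 b
    have hadj : (cocGraph n u).Adj (i, u (i + 1)) (⟨i.val + 1 + 0, hm⟩, 0) :=
      Or.inr (Or.inl ⟨rfl, rfl, rfl⟩)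
    refine ⟨w.append (.cons hadj w'), ?_⟩
    simp only [SimpleGraph.Walk.length_append, SimpleGraph.Walk.length_cons, hw, hw']
    simp
    ring
  | succ m ih =>
    obtain ⟨w, hw⟩ := ih (by omega) (u (i + 1 + m + 1))
    obtain ⟨w', hw'⟩ := exists_walk_octagon (u := u) ⟨i.val + 1 + (m + 1), hm⟩ 0 b
    have hadj : (cocGraph n u).Adj (⟨i.val + 1 + m, by omega⟩, u (i + 1 + m + 1))
        (⟨i.val + 1 + (m + 1), hm⟩, 0) :=
      Or.inr (Or.inl ⟨rfl, rfl, rfl⟩)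
    refine ⟨w.append (.cons hadj w'), ?_⟩
    have hp := position_succ (u := u) (i.val + 1 + m)
    simp only [SimpleGraph.Walk.length_append, SimpleGraph.Walk.length_cons, hw',
      ← add_assoc] at hw hp ⊢
    omega

/-- A function that changes by at most one along the edges of the chain and whose values to the
right of `(i, a)` are the distances from `(i, a)`. -/
def potential (u : ℕ → Fin 8) (i : ℕ) (a : Fin 8) (k : ℕ) (b : Fin 8) : ℕ :=
  if k < i then octDist a 0
  else if k = i then octDist a b
  else octDist a (u (i + 1)) + 1 + (position u k - position u (i + 1)) + octDist 0 b

/-- Octagons to the left of `i` carry the constant `octDist a 0`, the value at the vertex where the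
bridge from the left arrives, so nothing changes along the bridges there. It suffices to be exact on
the right, since distances are symmetric. -/
lemma potential_le_of_adj (i : ℕ) (a : Fin 8) {x y : Fin n × Fin 8}
    (h : (cocGraph n u).Adj x y) :
    potential u i a y.1 y.2 ≤ potential u i a x.1 x.2 + 1 := by
  obtain ⟨⟨k, hk⟩, b⟩ := x
  obtain ⟨⟨l, hl⟩, c⟩ := y
  rcases h with ⟨h1, h2⟩ | ⟨h1, h2, h3⟩ | ⟨h1, h2, h3⟩
  · simp only [Fin.mk.injEq] at h1
    subst h1
    have h4 := octDist_le_succ_of_adj h2 a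
    have h5 := octDist_le_succ_of_adj h2 0
    simp only [potential] at *
    split_ifs <;> omega
  · simp only at h1 h2 h3
    subst h1 h2 h3
    have h0 := octDist_self 0
    have hp := position_succ (u := u) k
    have hm : i + 1 ≤ k → position u (i + 1) ≤ position u k := fun h => position_mono h
    rcases lt_trichotomy k i with hki | rfl | hki
    · rcases (Nat.succ_le_of_lt hki).lt_or_eq with hki' | rfl
      · simp only [potential]
        rw [if_pos hki', if_pos hki]
        omega
      · simp [potential]
    · simp [potential, octDist_self]
    · simp only [potential]
      rw [if_neg (by omega), if_neg (by omega), if_neg (by omega), if_neg (by omega)]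
      omega
  · simp only at h1 h2 h3
    subst h1 h2 h3
    have h0 := octDist_self 0
    have hp := position_succ (u := u) l
    have hm : i + 1 ≤ l → position u (i + 1) ≤ position u l := fun h => position_mono h
    rcases lt_trichotomy l i with hki | rfl | hki
    · rcases (Nat.succ_le_of_lt hki).lt_or_eq with hki' | rfl
      · simp only [potential]
        rw [if_pos hki', if_pos hki]
        omega
      · simp [potential]
    · simp [potential, octDist_self]
      omega
    · simp only [potential]
      rw [if_neg (by omega), if_neg (by omega), if_neg (by omega), if_neg (by omega)]
      omega

/-- The lower bound for distances: the potential vanishes at `(i, a)`, so every walk from there is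
at least as long as the potential of its end. -/
lemma potential_le_length (i : ℕ) (a : Fin 8) {x y : Fin n × Fin 8} (w : (cocGraph n u).Walk x y) :
    potential u i a y.1 y.2 ≤ potential u i a x.1 x.2 + w.length := by
  induction w with
  | nil => simp
  | cons h w ih =>
    have := potential_le_of_adj i a h
    rw [SimpleGraph.Walk.length_cons]
    omega

lemma potential_self (i : ℕ) (a : Fin 8) : potential u i a i a = 0 := by
  simp [potential, octDist_self]

lemma dist_octagon (k : Fin n) (a b : Fin 8) :
    (cocGraph n u).dist (k, a) (k, b) = octDist a b := by
  obtain ⟨w, hw⟩ := exists_walk_octagon (u := u) k a b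
  refine le_antisymm (hw ▸ SimpleGraph.dist_le w) ?_
  obtain ⟨w', hw'⟩ := w.reachable.exists_walk_length_eq_dist
  have := potential_le_length k a w'
  rw [potential_self] at this
  simp only [potential] at this
  simp at this
  omega

lemma dist_of_lt {i j : Fin n} (hij : i < j) (a b : Fin 8) :
    (cocGraph n u).dist (i, a) (j, b) =
      octDist a (u (i + 1)) + 1 + (position u j - position u (i + 1)) + octDist 0 b := by
  obtain ⟨j, hj⟩ := j
  obtain ⟨m, rfl⟩ : ∃ m, j = i.val + 1 + m := Nat.exists_eq_add_of_le hij
  obtain ⟨w, hw⟩ := exists_walk_of_lt (u := u) i a m hj b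
  have hp : position u (i + 1) ≤ position u (i + 1 + m) := position_mono (by omega)
  have h1 := SimpleGraph.dist_le w
  obtain ⟨w', hw'⟩ := w.reachable.exists_walk_length_eq_dist
  have := potential_le_length i a w'
  rw [potential_self] at this
  simp only [potential] at this
  rw [if_neg (by omega), if_neg (by omega)] at this
  simp only
  omega

end CocGraph

/-! ### Degrees and the Gutman index as an affine function of the attaching distances. -/

lemma sum_sum_eq_diag_add_of_symm {ι : Type*} [LinearOrder ι] (s : Finset ι) (t : ι → ι → ℝ)
    (ht : ∀ i j, t i j = t j i) :
    ∑ i ∈ s, ∑ j ∈ s, t i j =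
      ∑ i ∈ s, t i i + 2 * ∑ i ∈ s, ∑ j ∈ s, if i < j then t i j else 0 := by
  have h1 : ∀ i j, t i j = (if i = j then t i j else 0) + (if i < j then t i j else 0)
      + (if j < i then t j i else 0) := by
    intro i j
    rcases lt_trichotomy i j with h | h | h
    · simp [h, h.ne, h.not_gt]
    · simp [h]
    · simp [h, h.ne', h.not_gt, ht i j]
  have h2 : ∑ i ∈ s, ∑ j ∈ s, (if j < i then t j i else 0) =
      ∑ i ∈ s, ∑ j ∈ s, if i < j then t i j else 0 := Finset.sum_comm
  have h3 : ∑ i ∈ s, ∑ j ∈ s, (if i = j then t i j else 0) = ∑ i ∈ s, t i i := by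
    refine Finset.sum_congr rfl fun i hi => ?_
    simp [hi]
  calc ∑ i ∈ s, ∑ j ∈ s, t i j
      = ∑ i ∈ s, ∑ j ∈ s, ((if i = j then t i j else 0) + (if i < j then t i j else 0)
          + (if j < i then t j i else 0)) :=
        Finset.sum_congr rfl fun i _ => Finset.sum_congr rfl fun j _ => h1 i j
    _ = _ := by simp only [Finset.sum_add_distrib, h2, h3]; ring

namespace CocGraph

variable {n : ℕ} {u : ℕ → Fin 8}

/-- The number of octagons attached to octagon `k` of a chain of `n` octagons on its right. -/
def rightEdge (n k : ℕ) : ℝ := if k + 1 < n then 1 else 0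

/-- The number of octagons attached to octagon `k` of a chain on its left. -/
def leftEdge (k : ℕ) : ℝ := if 0 < k then 1 else 0

/-- The sum of the degrees of the vertices of octagon `k`. -/
def octWeight (n k : ℕ) : ℝ := 16 + rightEdge n k + leftEdge k

open Classical in
lemma degree_eq (k : Fin n) (a : Fin 8) :
    ((cocGraph n u).degree (k, a) : ℝ) =
      2 + rightEdge n k * (if a = u (k + 1) then 1 else 0) +
        leftEdge k * (if a = 0 then 1 else 0) := by
  have h1 : ((cocGraph n u).degree (k, a) : ℝ) =
      ∑ l : Fin n, ∑ b : Fin 8, if (cocGraph n u).Adj (k, a) (l, b) then (1 : ℝ) else 0 := by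
    rw [← SimpleGraph.card_neighborFinset_eq_degree, SimpleGraph.neighborFinset_eq_filter,
      Finset.card_filter]
    push_cast
    rw [Fintype.sum_prod_type]
  have h2 : ∀ (l : Fin n) (b : Fin 8),
      (if (cocGraph n u).Adj (k, a) (l, b) then (1 : ℝ) else 0) =
        (if k = l then 1 else 0) * (if (SimpleGraph.cycleGraph 8).Adj a b then 1 else 0) +
        (if k.val + 1 = l.val then 1 else 0) *
          ((if a = u (k + 1) then 1 else 0) * if b = 0 then 1 else 0) +
        (if l.val + 1 = k.val then 1 else 0) *
          ((if b = u (l + 1) then 1 else 0) * if a = 0 then 1 else 0) := by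
    intro l b
    have hadj : (cocGraph n u).Adj (k, a) (l, b) ↔
        (k = l ∧ (SimpleGraph.cycleGraph 8).Adj a b) ∨
        (k.val + 1 = l.val ∧ a = u (k.val + 1) ∧ b = 0) ∨
        (l.val + 1 = k.val ∧ b = u (l.val + 1) ∧ a = 0) := Iff.rfl
    simp only [hadj, Fin.ext_iff (a := k)]
    by_cases h3 : k.val = l.val
    · simp [h3]
    by_cases h4 : k.val + 1 = l.val
    · have h5 : ¬ l.val + 1 = k.val := by omega
      simp only [h3, h4, h5, false_and, true_and, false_or, or_false, if_true, if_false]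
      split_ifs <;> simp_all
    by_cases h5 : l.val + 1 = k.val
    · simp only [h3, h4, h5, false_and, true_and, false_or, if_true, if_false]
      split_ifs <;> simp_all
    simp [h3, h4, h5]
  have h6 : ∑ l : Fin n, (if k.val + 1 = l.val then (1 : ℝ) else 0) = rightEdge n k := by
    rw [Fin.sum_univ_eq_sum_range (fun l => if k.val + 1 = l then (1 : ℝ) else 0)]
    simp [rightEdge]
  have h7 : ∑ l : Fin n, (if l.val + 1 = k.val then (1 : ℝ) else 0) = leftEdge k := by
    rw [Fin.sum_univ_eq_sum_range (fun l => if l + 1 = k.val then (1 : ℝ) else 0)]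
    obtain ⟨k, hk⟩ := k
    cases k with
    | zero => simp [leftEdge]
    | succ k => simp [leftEdge, show k < n by omega]
  have h8 : ∑ b, (if (SimpleGraph.cycleGraph 8).Adj a b then (1 : ℝ) else 0) = 2 := by
    have := sum_cycleGraph_adj a
    rw [← Nat.cast_inj (R := ℝ)] at this
    push_cast at this
    convert this
  simp only [h1, h2, Finset.sum_add_distrib, ← Finset.mul_sum, h8, ← Finset.sum_mul, h6]
  simp [h7]

/-- The cast of the distance in an octagon between the vertex `x_1` and the attaching vertex. -/
def attachDist (u : ℕ → Fin 8) (k : ℕ) : ℝ := octDist 0 (u (k + 1))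

open Classical in
lemma sum_degree_mul (k : Fin n) (g : Fin 8 → ℝ) :
    ∑ a, ((cocGraph n u).degree (k, a) : ℝ) * g a =
      2 * ∑ a, g a + rightEdge n k * g (u (k + 1)) + leftEdge k * g 0 := by
  simp only [degree_eq, add_mul, Finset.sum_add_distrib, mul_assoc, ← Finset.mul_sum]
  simp

/-- The contribution of the octagons `i < j` to the sum of products of degrees and distances. -/
def crossTerm (n : ℕ) (u : ℕ → Fin 8) (i j : ℕ) : ℝ :=
  octWeight n j * (32 + leftEdge i * attachDist u i)
    + octWeight n i * (32 + rightEdge n j * attachDist u j)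
    + octWeight n i * octWeight n j *
      (1 + ∑ k ∈ Finset.range n,
        (if i < k then 1 else 0) * (if k < j then 1 else 0) * (attachDist u k + 1))

lemma sum_octDist_cast (a : Fin 8) : ∑ b, (octDist a b : ℝ) = 16 := by
  exact_mod_cast sum_octDist a

/-- Indicators over the full range replace the interval between `i` and `j`, so that the triple sum
over `i`, `j`, `k` can later be reordered freely. -/
lemma position_sub {i j : ℕ} (hij : i < j) (hj : j < n) :
    ((position u j - position u (i + 1) : ℕ) : ℝ) =
      ∑ k ∈ Finset.range n,
        (if i < k then 1 else 0) * (if k < j then 1 else 0) * (attachDist u k + 1) := by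
  rw [Nat.cast_sub (position_mono hij)]
  unfold position
  push_cast
  rw [← Finset.sum_Ico_eq_sub _ (Nat.succ_le_of_lt hij)]
  have : Finset.Ico (i + 1) j = (Finset.range n).filter fun k => i < k ∧ k < j := by
    ext k
    simp
    omega
  rw [this, Finset.sum_filter]
  refine Finset.sum_congr rfl fun k _ => ?_
  by_cases h1 : i < k <;> by_cases h2 : k < j <;> simp [h1, h2, attachDist]

-- The distance is a function of `a` plus a constant plus a function of `b`, so the double sum
-- reduces to single sums weighted by degrees.
open Classical in
lemma sum_sum_degree_dist_of_lt {i j : Fin n} (hij : i < j) :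
    ∑ a, ∑ b, ((cocGraph n u).degree (i, a) : ℝ) * ((cocGraph n u).degree (j, b) : ℝ) *
      ((cocGraph n u).dist (i, a) (j, b) : ℝ) = crossTerm n u i j := by
  set L : ℝ := ∑ k ∈ Finset.range n,
    (if i.val < k then 1 else 0) * (if k < j.val then 1 else 0) * (attachDist u k + 1) with hL
  have hdist : ∀ a b, ((cocGraph n u).dist (i, a) (j, b) : ℝ) =
      octDist a (u (i + 1)) + (1 + L) + octDist 0 b := by
    intro a b
    rw [dist_of_lt hij]
    push_cast
    rw [position_sub hij j.isLt, hL]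
    ring
  have hi : rightEdge n i = 1 := by
    rw [rightEdge, if_pos]
    have := j.isLt
    have : i.val < j.val := hij
    omega
  have hcomm : ∀ a, (octDist a (u (i + 1)) : ℝ) = octDist (u (i + 1)) a := fun a => by
    rw [octDist_comm]
  have hb : ∀ x : ℝ, ∑ b, ((cocGraph n u).degree (j, b) : ℝ) * (x + octDist 0 b) =
      octWeight n j * x + (32 + rightEdge n j * attachDist u j) := by
    intro x
    rw [sum_degree_mul]
    simp only [Finset.sum_add_distrib, sum_octDist_cast, octDist_self, octWeight, attachDist]
    simp
    ring
  rw [crossTerm, ← hL]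
  clear_value L
  simp only [hdist, mul_assoc, ← Finset.mul_sum, hb]
  rw [sum_degree_mul]
  simp only [Finset.sum_add_distrib, ← Finset.mul_sum, hcomm, sum_octDist_cast, octDist_self, hi]
  simp only [octWeight, attachDist, hi, octDist_comm (u (i + 1)) 0]
  simp
  ring

open Classical in
lemma sum_sum_degree_dist_self (i : Fin n) :
    ∑ a, ∑ b, ((cocGraph n u).degree (i, a) : ℝ) * ((cocGraph n u).degree (i, b) : ℝ) *
      ((cocGraph n u).dist (i, a) (i, b) : ℝ) =
      512 + 64 * (rightEdge n i + leftEdge i) + 2 * (rightEdge n i * leftEdge i) *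
        attachDist u i := by
  have hb : ∀ a, ∑ b, ((cocGraph n u).degree (i, b) : ℝ) * (octDist a b) =
      32 + rightEdge n i * octDist (u (i + 1)) a + leftEdge i * octDist 0 a := by
    intro a
    rw [sum_degree_mul, sum_octDist_cast, octDist_comm a 0, octDist_comm a]
    ring
  simp only [dist_octagon, mul_assoc, ← Finset.mul_sum, hb]
  rw [sum_degree_mul]
  simp only [Finset.sum_add_distrib, ← Finset.mul_sum, sum_octDist_cast, octDist_self,
    attachDist, octDist_comm (u (i + 1)) 0]
  simp
  ring

lemma gutmanIndex_cocGraph :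
    gutmanIndex (cocGraph n u) =
      ∑ i ∈ Finset.range n, (256 + 32 * (rightEdge n i + leftEdge i) +
        rightEdge n i * leftEdge i * attachDist u i) +
      ∑ i ∈ Finset.range n, ∑ j ∈ Finset.range n, if i < j then crossTerm n u i j else 0 := by
  classical
  unfold gutmanIndex
  have h1 : ∑ x : Fin n × Fin 8, ∑ y : Fin n × Fin 8,
      ((cocGraph n u).degree x : ℝ) * ((cocGraph n u).degree y : ℝ) *
        ((cocGraph n u).dist x y : ℝ) =
      ∑ i : Fin n, ∑ j : Fin n, ∑ a, ∑ b, ((cocGraph n u).degree (i, a) : ℝ) *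
        ((cocGraph n u).degree (j, b) : ℝ) * ((cocGraph n u).dist (i, a) (j, b) : ℝ) := by
    simp only [Fintype.sum_prod_type]
    exact Finset.sum_congr rfl fun i _ => Finset.sum_comm
  have h2 := sum_sum_eq_diag_add_of_symm (Finset.univ : Finset (Fin n))
    (fun i j => ∑ a, ∑ b, ((cocGraph n u).degree (i, a) : ℝ) *
        ((cocGraph n u).degree (j, b) : ℝ) * ((cocGraph n u).dist (i, a) (j, b) : ℝ))
    (by
      intro i j
      rw [Finset.sum_comm]
      refine Finset.sum_congr rfl fun a _ => Finset.sum_congr rfl fun b _ => ?_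
      rw [SimpleGraph.dist_comm]
      ring)
  have h3 : ∀ i j : Fin n, (if i < j then ∑ a, ∑ b, ((cocGraph n u).degree (i, a) : ℝ) *
        ((cocGraph n u).degree (j, b) : ℝ) * ((cocGraph n u).dist (i, a) (j, b) : ℝ) else 0) =
      if i.val < j.val then crossTerm n u i j else 0 := by
    intro i j
    by_cases h : i < j
    · rw [if_pos h, if_pos (Fin.lt_def.1 h), sum_sum_degree_dist_of_lt h]
    · rw [if_neg h, if_neg (mt Fin.lt_def.2 h)]
  have h4 : ∀ F : ℕ → ℕ → ℝ, ∑ i : Fin n, ∑ j : Fin n, F i j =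
      ∑ i ∈ Finset.range n, ∑ j ∈ Finset.range n, F i j := by
    intro F
    rw [← Fin.sum_univ_eq_sum_range (fun i => ∑ j ∈ Finset.range n, F i j)]
    exact Finset.sum_congr rfl fun i _ => Fin.sum_univ_eq_sum_range (fun j => F i j) n
  rw [← Fin.sum_univ_eq_sum_range (fun i => 256 + 32 * (rightEdge n i + leftEdge i) +
        rightEdge n i * leftEdge i * attachDist u i), ← h4]
  rw [h1, h2]
  simp only [sum_sum_degree_dist_self, h3, mul_add, Finset.mul_sum]
  congr 1
  · refine Finset.sum_congr rfl fun i _ => ?_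
    ring
  · refine Finset.sum_congr rfl fun i _ => Finset.sum_congr rfl fun j _ => ?_
    ring

/-- Every octagon to the left of `k` has degree sum 18, two bridges included, except octagon 0,
which has no left bridge. -/
lemma sum_octWeight_lt {k : ℕ} (hk : k < n) :
    ∑ i ∈ Finset.range n, (if i < k then 1 else 0) * octWeight n i = 18 * k - leftEdge k := by
  have h1 : ∑ i ∈ Finset.range n, (if i < k then 1 else 0) * octWeight n i =
      ∑ i ∈ Finset.range k, (17 + leftEdge i) := by
    have : Finset.range k = (Finset.range n).filter (· < k) := by
      ext i
      simp
      omega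
    rw [this, Finset.sum_filter]
    refine Finset.sum_congr rfl fun i _ => ?_
    by_cases h : i < k
    · simp only [if_pos h, octWeight, rightEdge, if_pos (show i + 1 < n by omega)]
      ring
    · simp [h]
  have h2 : ∀ m : ℕ, ∑ i ∈ Finset.range m, (17 + leftEdge i) = 18 * m - leftEdge m := by
    intro m
    induction m with
    | zero => simp [leftEdge]
    | succ m ih =>
      rw [Finset.sum_range_succ, ih]
      simp [leftEdge]
      ring
  rw [h1, h2]

/-- The mirror image of `sum_octWeight_lt`: the exceptional octagon is the last one, which has no
right bridge. -/
lemma sum_octWeight_gt {k : ℕ} (hk : k < n) :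
    ∑ j ∈ Finset.range n, (if k < j then 1 else 0) * octWeight n j =
      18 * ((n : ℝ) - 1 - k) - rightEdge n k := by
  obtain ⟨m, rfl⟩ : ∃ m, n = k + 1 + m := Nat.exists_eq_add_of_le hk
  have h1 : ∑ j ∈ Finset.range (k + 1), (if k < j then 1 else 0) * octWeight (k + 1 + m) j = 0 := by
    refine Finset.sum_eq_zero fun j hj => ?_
    rw [Finset.mem_range] at hj
    rw [if_neg (by omega), zero_mul]
  rw [Finset.sum_range_add, h1, zero_add]
  have h2 : ∀ x, (if k < k + 1 + x then 1 else 0) * octWeight (k + 1 + m) (k + 1 + x) =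
      17 + if x + 1 < m then 1 else 0 := by
    intro x
    have : (k + 1 + x + 1 < k + 1 + m) ↔ x + 1 < m := by omega
    simp only [octWeight, leftEdge, rightEdge, this]
    rw [if_pos (show k < k + 1 + x by omega), if_pos (show 0 < k + 1 + x by omega)]
    ring
  simp only [h2]
  cases m with
  | zero => simp [rightEdge]
  | succ m =>
    rw [Finset.sum_range_succ]
    have h3 : ∑ x ∈ Finset.range m, ((17 : ℝ) + if x + 1 < m + 1 then 1 else 0) = m * 18 := by
      rw [Finset.sum_congr rfl (g := fun _ => (18 : ℝ)), Finset.sum_const, Finset.card_range,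
        nsmul_eq_mul]
      intro x hx
      rw [Finset.mem_range] at hx
      rw [if_pos (by omega)]
      norm_num
    rw [h3]
    simp [rightEdge]
    ring

/-- The part of the Gutman index of a chain of `n` octagons that does not depend on the attaching
vertices. -/
def gutConst (n : ℕ) : ℝ :=
  ∑ i ∈ Finset.range n, (256 + 32 * (rightEdge n i + leftEdge i)) +
    ∑ i ∈ Finset.range n, ∑ j ∈ Finset.range n, if i < j then
      octWeight n j * 32 + octWeight n i * 32 + octWeight n i * octWeight n j *
        (1 + ∑ k ∈ Finset.range n, (if i < k then 1 else 0) * (if k < j then 1 else 0))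
      else 0

theorem gutmanIndex_eq :
    gutmanIndex (cocGraph n u) =
      gutConst n + 324 * ∑ k ∈ Finset.range n, k * ((n : ℝ) - 1 - k) * attachDist u k := by
  have hcross : ∀ i j : ℕ, (if i < j then crossTerm n u i j else 0) =
      (if i < j then
      octWeight n j * 32 + octWeight n i * 32 + octWeight n i * octWeight n j *
        (1 + ∑ k ∈ Finset.range n, (if i < k then 1 else 0) * (if k < j then 1 else 0))
      else 0) + leftEdge i * attachDist u i * ((if i < j then 1 else 0) * octWeight n j)
      + rightEdge n j * attachDist u j * ((if i < j then 1 else 0) * octWeight n i)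
      + ∑ k ∈ Finset.range n, attachDist u k * (((if i < k then 1 else 0) * octWeight n i) *
          ((if k < j then 1 else 0) * octWeight n j)) := by
    intro i j
    by_cases h : i < j
    · simp only [if_pos h, crossTerm, mul_add, Finset.sum_add_distrib, Finset.mul_sum]
      have : ∀ k, octWeight n i * octWeight n j *
          ((if i < k then 1 else 0) * (if k < j then 1 else 0) * attachDist u k) =
          attachDist u k * (((if i < k then 1 else 0) * octWeight n i) *
          ((if k < j then 1 else 0) * octWeight n j)) := fun k => by ring
      simp only [this]
      ring_nf
    · have : ∀ k, ((if i < k then (1 : ℝ) else 0) * octWeight n i) *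
          ((if k < j then 1 else 0) * octWeight n j) = 0 := by
        intro k
        by_cases h1 : i < k
        · rw [if_neg (show ¬ k < j by omega)]
          ring
        · rw [if_neg h1]
          ring
      simp only [if_neg h, this]
      simp
  have htriple : ∑ i ∈ Finset.range n, ∑ j ∈ Finset.range n, ∑ k ∈ Finset.range n,
      attachDist u k * (((if i < k then 1 else 0) * octWeight n i) *
          ((if k < j then 1 else 0) * octWeight n j)) =
      ∑ k ∈ Finset.range n, attachDist u k *
        ((∑ i ∈ Finset.range n, (if i < k then 1 else 0) * octWeight n i) *
          ∑ j ∈ Finset.range n, (if k < j then 1 else 0) * octWeight n j) := by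
    rw [Finset.sum_congr rfl fun i _ => Finset.sum_comm, Finset.sum_comm]
    refine Finset.sum_congr rfl fun k _ => ?_
    rw [Finset.sum_mul_sum]
    simp only [Finset.mul_sum]
  have hright : ∑ i ∈ Finset.range n, ∑ j ∈ Finset.range n,
      rightEdge n j * attachDist u j * ((if i < j then 1 else 0) * octWeight n i) =
      ∑ k ∈ Finset.range n, rightEdge n k * attachDist u k *
        ∑ i ∈ Finset.range n, (if i < k then 1 else 0) * octWeight n i := by
    rw [Finset.sum_comm]
    simp only [Finset.mul_sum]
  rw [gutmanIndex_cocGraph, gutConst]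
  simp only [hcross, Finset.sum_add_distrib, htriple, hright]
  simp only [← Finset.mul_sum]
  -- With `l`, `r` the edge indicators of octagon `k`, the four contributions are the expansion of
  -- `(l + (18 k - l)) (r + (18 (n - 1 - k) - r))`: pairs of half-edges separated by the passage
  -- from `x_1` to the attaching vertex. Hence `324 = 18²`.
  have hcoef : ∑ k ∈ Finset.range n, rightEdge n k * leftEdge k * attachDist u k +
      ∑ k ∈ Finset.range n, leftEdge k * attachDist u k *
        ∑ j ∈ Finset.range n, (if k < j then 1 else 0) * octWeight n j +
      ∑ k ∈ Finset.range n, rightEdge n k * attachDist u k *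
        ∑ i ∈ Finset.range n, (if i < k then 1 else 0) * octWeight n i +
      ∑ k ∈ Finset.range n, attachDist u k *
        ((∑ i ∈ Finset.range n, (if i < k then 1 else 0) * octWeight n i) *
          ∑ j ∈ Finset.range n, (if k < j then 1 else 0) * octWeight n j) =
      324 * ∑ k ∈ Finset.range n, k * ((n : ℝ) - 1 - k) * attachDist u k := by
    simp only [← Finset.sum_add_distrib, Finset.mul_sum (s := Finset.range n) (a := (324 : ℝ))]
    refine Finset.sum_congr rfl fun k hk => ?_
    rw [Finset.mem_range] at hk
    rw [sum_octWeight_lt hk, sum_octWeight_gt hk]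
    ring
  linarith

end CocGraph

/-! ### Characteristic functions and the central limit theorem. -/

/-- Exchange one factor at a time; the remaining factors lie in the unit disc and do not enlarge the
error. -/
lemma norm_prod_sub_prod_le {ι : Type*} (s : Finset ι) (a b : ι → ℂ)
    (ha : ∀ i ∈ s, ‖a i‖ ≤ 1) (hb : ∀ i ∈ s, ‖b i‖ ≤ 1) :
    ‖∏ i ∈ s, a i - ∏ i ∈ s, b i‖ ≤ ∑ i ∈ s, ‖a i - b i‖ := by
  classical
  induction s using Finset.induction_on with
  | empty => simp
  | insert i s hi ih =>
    rw [Finset.prod_insert hi, Finset.prod_insert hi, Finset.sum_insert hi]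
    have h1 := ih (fun j hj => ha j (Finset.mem_insert_of_mem hj))
      (fun j hj => hb j (Finset.mem_insert_of_mem hj))
    have h2 : ‖∏ j ∈ s, b j‖ ≤ 1 := by
      rw [norm_prod]
      exact Finset.prod_le_one (fun _ _ => norm_nonneg _)
        fun j hj => hb j (Finset.mem_insert_of_mem hj)
    have h3 := ha i (Finset.mem_insert_self _ _)
    calc ‖a i * ∏ j ∈ s, a j - b i * ∏ j ∈ s, b j‖
        = ‖(a i - b i) * ∏ j ∈ s, b j + a i * (∏ j ∈ s, a j - ∏ j ∈ s, b j)‖ := by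
          congr 1
          ring
      _ ≤ ‖a i - b i‖ * ‖∏ j ∈ s, b j‖ + ‖a i‖ * ‖∏ j ∈ s, a j - ∏ j ∈ s, b j‖ := by
          rw [← norm_mul, ← norm_mul]
          exact norm_add_le _ _
      _ ≤ ‖a i - b i‖ * 1 + 1 * ∑ j ∈ s, ‖a j - b j‖ := by gcongr
      _ = _ := by ring

lemma norm_exp_mul_I_sub_le {x : ℝ} (hx : |x| ≤ 1) :
    ‖Complex.exp (x * Complex.I) - (1 + x * Complex.I - x ^ 2 / 2)‖ ≤ |x| ^ 3 := by
  have hn : ‖(x : ℂ) * Complex.I‖ = |x| := by simp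
  have h := Complex.exp_bound (x := x * Complex.I) (by rwa [hn]) (n := 3) (by norm_num)
  rw [hn] at h
  have h2 : ∑ m ∈ Finset.range 3, ((x : ℂ) * Complex.I) ^ m / m.factorial =
      1 + x * Complex.I - x ^ 2 / 2 := by
    simp [Finset.sum_range_succ, Nat.factorial, mul_pow]
    ring
  rw [h2] at h
  refine h.trans ?_
  have : 0 ≤ |x| ^ 3 := by positivity
  norm_num [Nat.factorial]
  nlinarith

section CentralLimit

variable {Ω : Type*} [MeasurableSpace Ω] {P : Measure Ω} [IsProbabilityMeasure P]

/-- Both functions are compared with the quadratic Taylor polynomial `1 - v s² / 2`, each at a cost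
of `|s|³ M³`. -/
lemma norm_charFun_sub_exp_le {X : Ω → ℝ} {M v s : ℝ} (hX : Measurable X)
    (hM : ∀ ω, |X ω| ≤ M) (h0 : ∫ ω, X ω ∂P = 0) (hv : ∫ ω, X ω ^ 2 ∂P = v)
    (hs : |s| * M ≤ 1) :
    ‖charFun (P.map X) s - Real.exp (-(v * s ^ 2 / 2))‖ ≤ 2 * (|s| ^ 3 * M ^ 3) := by
  have : Nonempty Ω := nonempty_of_isProbabilityMeasure P
  have hM0 : 0 ≤ M := (abs_nonneg _).trans (hM (Classical.arbitrary Ω))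
  have hint : Integrable X P :=
    Integrable.of_bound hX.aestronglyMeasurable M (ae_of_all _ hM)
  have hsq : ∀ ω, |X ω ^ 2| ≤ M ^ 2 := fun ω => by
    rw [abs_pow]
    exact pow_le_pow_left₀ (abs_nonneg _) (hM ω) 2
  have hint2 : Integrable (fun ω => X ω ^ 2) P :=
    Integrable.of_bound (hX.pow_const 2).aestronglyMeasurable (M ^ 2) (ae_of_all _ hsq)
  have hv0 : 0 ≤ v := hv ▸ integral_nonneg fun ω => sq_nonneg _
  have hvM : v ≤ M ^ 2 := by
    rw [← hv]
    calc ∫ ω, X ω ^ 2 ∂P ≤ ∫ _, M ^ 2 ∂P :=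
          integral_mono hint2 (integrable_const _) fun ω => (le_abs_self _).trans (hsq ω)
      _ = M ^ 2 := by simp
  have h1 : charFun (P.map X) s = ∫ ω, Complex.exp ((s * X ω : ℝ) * Complex.I) ∂P := by
    rw [charFun_apply_real, integral_map hX.aemeasurable (by fun_prop)]
    simp
  have h2 : ∫ ω, ((1 : ℂ) + ((s * X ω : ℝ) : ℂ) * Complex.I - ((s * X ω : ℝ) : ℂ) ^ 2 / 2) ∂P =
      ((1 - v * s ^ 2 / 2 : ℝ) : ℂ) := by
    have e1 : ∀ ω, (1 : ℂ) + ((s * X ω : ℝ) : ℂ) * Complex.I - ((s * X ω : ℝ) : ℂ) ^ 2 / 2 =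
        (1 : ℂ) + (X ω : ℂ) * (s * Complex.I) - ((X ω ^ 2 : ℝ) : ℂ) * (s ^ 2 / 2) := by
      intro ω
      push_cast
      ring
    simp only [e1]
    rw [integral_sub, integral_add, integral_mul_const, integral_mul_const,
      integral_complex_ofReal, integral_complex_ofReal, h0, hv]
    · simp
      ring
    · exact integrable_const _
    · exact hint.ofReal.mul_const _
    · exact (integrable_const _).add (hint.ofReal.mul_const _)
    · exact hint2.ofReal.mul_const _
  have hbd : ∀ ω, |s * X ω| ≤ |s| * M := fun ω => by
    rw [abs_mul]
    exact mul_le_mul_of_nonneg_left (hM ω) (abs_nonneg _)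
  have h3 : ‖charFun (P.map X) s - ((1 - v * s ^ 2 / 2 : ℝ) : ℂ)‖ ≤ |s| ^ 3 * M ^ 3 := by
    rw [h1, ← h2, ← integral_sub]
    · have := norm_integral_le_of_norm_le_const (μ := P) (C := |s| ^ 3 * M ^ 3)
        (f := fun ω => Complex.exp ((s * X ω : ℝ) * Complex.I) -
          ((1 : ℂ) + ((s * X ω : ℝ) : ℂ) * Complex.I - ((s * X ω : ℝ) : ℂ) ^ 2 / 2))
        (ae_of_all _ fun ω => by
          refine (norm_exp_mul_I_sub_le ((hbd ω).trans hs)).trans ?_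
          rw [← mul_pow]
          exact pow_le_pow_left₀ (abs_nonneg _) (hbd ω) 3)
      simpa using this
    · refine Integrable.of_bound (by fun_prop) 1 (ae_of_all _ fun ω => ?_)
      rw [Complex.norm_exp_ofReal_mul_I]
    · have e1 : (fun ω => (1 : ℂ) + ((s * X ω : ℝ) : ℂ) * Complex.I
          - ((s * X ω : ℝ) : ℂ) ^ 2 / 2) = fun ω =>
          (1 : ℂ) + (X ω : ℂ) * (s * Complex.I) - ((X ω ^ 2 : ℝ) : ℂ) * (s ^ 2 / 2) := by
        funext ω
        push_cast
        ring
      rw [e1]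
      exact ((integrable_const _).add (hint.ofReal.mul_const _)).sub (hint2.ofReal.mul_const _)
  have hy0 : 0 ≤ v * s ^ 2 / 2 := by positivity
  -- The exponential error is at most `y²` with `y = v s² / 2`. Bounding one factor by `s² M²` and
  -- the other by `|s| M` makes it cubic, like the other error.
  have hss : s ^ 2 * M ^ 2 ≤ |s| * M := by
    have : s ^ 2 * M ^ 2 = (|s| * M) * (|s| * M) := by
      rw [← sq_abs s]
      ring
    rw [this]
    exact mul_le_of_le_one_right (by positivity) hs
  have hy : v * s ^ 2 / 2 ≤ s ^ 2 * M ^ 2 := by nlinarith [sq_nonneg s, sq_nonneg M]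
  have h4 := Real.norm_exp_sub_one_sub_id_le (x := -(v * s ^ 2 / 2)) (by
    rw [norm_neg, Real.norm_of_nonneg hy0]
    linarith)
  have h5 : ‖((1 - v * s ^ 2 / 2 : ℝ) : ℂ) - Real.exp (-(v * s ^ 2 / 2))‖ ≤
      |s| ^ 3 * M ^ 3 := by
    rw [← Complex.ofReal_sub, Complex.norm_real, norm_sub_rev]
    have e1 : Real.exp (-(v * s ^ 2 / 2)) - (1 - v * s ^ 2 / 2) =
        Real.exp (-(v * s ^ 2 / 2)) - 1 - -(v * s ^ 2 / 2) := by ring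
    rw [e1]
    refine h4.trans ?_
    rw [norm_neg, Real.norm_of_nonneg hy0]
    calc (v * s ^ 2 / 2) ^ 2 = (v * s ^ 2 / 2) * (v * s ^ 2 / 2) := by ring
      _ ≤ (s ^ 2 * M ^ 2) * (|s| * M) := by
          gcongr
          exact hy.trans hss
      _ = |s| ^ 3 * M ^ 3 := by
          rw [← sq_abs s]
          ring
  calc _ ≤ _ := norm_sub_le_norm_sub_add_norm_sub _ ((1 - v * s ^ 2 / 2 : ℝ) : ℂ) _
    _ ≤ 2 * (|s| ^ 3 * M ^ 3) := by linarith

/-- The central limit theorem for weighted sums of uniformly bounded, centered, independent random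
variables with common variance, if the weights tend to zero uniformly. -/
theorem tendsto_charFun_weighted_sum {X : ℕ → Ω → ℝ} {M v : ℝ} (hindep : iIndepFun X P)
    (hX : ∀ k, Measurable (X k)) (hM : ∀ k ω, |X k ω| ≤ M) (h0 : ∀ k, ∫ ω, X k ω ∂P = 0)
    (hv : ∀ k, ∫ ω, X k ω ^ 2 ∂P = v) {b : ℕ → ℕ → ℝ} {B : ℕ → ℝ}
    (hb : ∀ n, ∀ k < n, |b n k| ≤ B n) (hB : Tendsto B atTop (𝓝 0))
    (hsum : ∀ᶠ n in atTop, v * ∑ k ∈ Finset.range n, b n k ^ 2 = 1) (t : ℝ) :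
    Tendsto (fun n => charFun (P.map fun ω => ∑ k ∈ Finset.range n, b n k * X k ω) t) atTop
      (𝓝 (Real.exp (-(t ^ 2 / 2)))) := by
  have : Nonempty Ω := nonempty_of_isProbabilityMeasure P
  have hM0 : 0 ≤ M := (abs_nonneg _).trans (hM 0 (Classical.arbitrary Ω))
  have hprod : ∀ n, charFun (P.map fun ω => ∑ k ∈ Finset.range n, b n k * X k ω) t =
      ∏ k ∈ Finset.range n, charFun (P.map (X k)) (b n k * t) := by
    intro n
    have hi : iIndepFun (fun k ω => b n k * X k ω) P :=
      hindep.comp (fun k x => b n k * x) fun k => by fun_prop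
    rw [(hi.restrict _).charFun_map_fun_finsetSum_eq_prod
      (fun k _ => ((hX k).const_mul _).aemeasurable), Finset.prod_apply]
    exact Finset.prod_congr rfl fun k _ => charFun_map_mul_comp (hX k).aemeasurable _ _
  have hlim : Tendsto (fun n => 2 * (|t| ^ 3 * M ^ 3) * (B n / v)) atTop (𝓝 0) := by
    simpa using (hB.div_const v).const_mul (2 * (|t| ^ 3 * M ^ 3))
  have hsmall : ∀ᶠ n in atTop, B n * (|t| * M) < 1 := by
    have : Tendsto (fun n => B n * (|t| * M)) atTop (𝓝 0) := by
      simpa using hB.mul_const (|t| * M)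
    exact this.eventually_lt_const one_pos
  rw [tendsto_iff_norm_sub_tendsto_zero]
  refine squeeze_zero' (Eventually.of_forall fun _ => norm_nonneg _) ?_ hlim
  filter_upwards [hsum, hsmall] with n hn hn'
  -- If `v` were zero, the normalization `hn` would read `0 = 1`.
  have hv0 : 0 < v := by
    have h1 : 0 ≤ v := hv 0 ▸ integral_nonneg fun ω => sq_nonneg _
    refine h1.lt_of_ne ?_
    rintro rfl
    simp at hn
  -- The normalization `v ∑ b² = 1` splits the Gaussian into one factor per summand, so the two
  -- products can be compared factor by factor.
  have hexp : (Real.exp (-(t ^ 2 / 2)) : ℂ) =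
      ∏ k ∈ Finset.range n, ((Real.exp (-(v * (b n k * t) ^ 2 / 2)) : ℝ) : ℂ) := by
    rw [← Complex.ofReal_prod, ← Real.exp_sum]
    congr 2
    have : ∀ k, -(v * (b n k * t) ^ 2 / 2) = (v * b n k ^ 2) * (-(t ^ 2 / 2)) := fun k => by ring
    simp only [this]
    rw [← Finset.sum_mul, ← Finset.mul_sum, hn, one_mul]
  rw [hprod, hexp]
  have hprob : ∀ k, IsProbabilityMeasure (P.map (X k)) := fun k =>
    Measure.isProbabilityMeasure_map (hX k).aemeasurable
  refine (norm_prod_sub_prod_le _ _ _ (fun k _ => norm_charFun_le_one _) fun k _ => ?_).trans ?_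
  · rw [Complex.norm_real, Real.norm_of_nonneg (Real.exp_nonneg _), Real.exp_le_one_iff]
    have : 0 ≤ v * (b n k * t) ^ 2 / 2 := by positivity
    linarith
  · calc ∑ k ∈ Finset.range n, ‖charFun (P.map (X k)) (b n k * t) -
          ((Real.exp (-(v * (b n k * t) ^ 2 / 2)) : ℝ) : ℂ)‖
        ≤ ∑ k ∈ Finset.range n, 2 * (|t| ^ 3 * M ^ 3) * B n * b n k ^ 2 := by
          refine Finset.sum_le_sum fun k hk => ?_
          have hbk := hb n k (Finset.mem_range.1 hk)
          refine (norm_charFun_sub_exp_le (hX k) (hM k) (h0 k) (hv k) ?_).trans ?_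
          · rw [abs_mul, mul_assoc]
            exact (mul_le_mul_of_nonneg_right hbk (by positivity)).trans hn'.le
          -- One of the three factors is traded for the uniform bound; the remaining squares sum to
          -- `1 / v`.
          · have : |b n k| ^ 3 ≤ B n * b n k ^ 2 := by
              rw [← sq_abs (b n k), pow_succ']
              exact mul_le_mul_of_nonneg_right hbk (by positivity)
            calc 2 * (|b n k * t| ^ 3 * M ^ 3) = 2 * (|t| ^ 3 * M ^ 3) * |b n k| ^ 3 := by
                  rw [abs_mul]
                  ring
              _ ≤ 2 * (|t| ^ 3 * M ^ 3) * (B n * b n k ^ 2) := by gcongr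
              _ = _ := by ring
      _ = 2 * (|t| ^ 3 * M ^ 3) * (B n / v) := by
          rw [← Finset.mul_sum]
          have : ∑ k ∈ Finset.range n, b n k ^ 2 = 1 / v := by
            rw [eq_div_iff hv0.ne', mul_comm]
            exact hn
          rw [this]
          ring

end CentralLimit

/-! ### Uniform convergence of distribution functions. -/

/-- **Pólya's theorem**: pointwise convergence of distribution functions to a continuous
distribution function is uniform. -/
theorem tendsto_iSup_abs_sub_of_monotone {F : ℕ → ℝ → ℝ} {G : ℝ → ℝ} (hF : ∀ n, Monotone (F n))
    (hF0 : ∀ n x, 0 ≤ F n x) (hF1 : ∀ n x, F n x ≤ 1) (hG : Monotone G) (hGc : Continuous G)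
    (hG0 : Tendsto G atBot (𝓝 0)) (hG1 : Tendsto G atTop (𝓝 1))
    (h : ∀ x, Tendsto (fun n => F n x) atTop (𝓝 (G x))) :
    Tendsto (fun n => ⨆ a, |F n a - G a|) atTop (𝓝 0) := by
  have hGn : ∀ x, 0 ≤ G x := fun x => hG.le_of_tendsto hG0 x
  have hGl : ∀ x, G x ≤ 1 := fun x => hG.ge_of_tendsto hG1 x
  rw [Metric.tendsto_atTop']
  intro ε hε
  obtain ⟨K, hK⟩ := exists_nat_gt (2 / ε)
  have hK0 : (0 : ℝ) < K := lt_trans (by positivity) hK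
  have hKε : 2 / (K : ℝ) < ε := by
    rw [div_lt_iff₀ hε] at hK
    rw [div_lt_iff₀ hK0]
    linarith
  -- The grid consists of quantiles of `G`. Between neighbouring grid points `G` grows by `1 / K`,
  -- and another `1 / K` is the error of `F n` at the grid points; this is the `2 / K` below.
  have hx : ∀ j : ℕ, 0 < j → j < K → ∃ x, G x = j / K := by
    intro j hj hjK
    have h1 : (0 : ℝ) < j / K := by positivity
    have h2 : (j : ℝ) / K < 1 := by
      rw [div_lt_one hK0]
      exact_mod_cast hjK
    obtain ⟨a, ha⟩ := (hG0.eventually_lt_const h1).exists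
    obtain ⟨c, hc⟩ := (hG1.eventually_const_lt h2).exists
    exact mem_range_of_exists_le_of_exists_ge hGc ⟨a, ha.le⟩ ⟨c, hc.le⟩
  choose! x hx using hx
  have hev : ∀ᶠ n in atTop, ∀ j ∈ Finset.range K, |F n (x j) - G (x j)| < 1 / K := by
    rw [eventually_all_finset]
    intro j _
    have := (h (x j)).sub_const (G (x j))
    rw [sub_self] at this
    exact this.abs.eventually_lt_const (by simpa using hK0)
  have key : ∀ᶠ n in atTop, ∀ a, |F n a - G a| ≤ 2 / K := by
    filter_upwards [hev] with n hn a
    have e2 : 2 / (K : ℝ) = 1 / K + 1 / K := by ring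
    have hKG : 0 ≤ K * G a := mul_nonneg hK0.le (hGn a)
    rw [abs_le]
    constructor
    -- The nearest grid point to the left is `x j` with `j = ⌈K * G a⌉₊ - 1`: the ceiling makes `G
    -- (x j) < G a` strict, and only a strict inequality yields `x j < a`. Without such a grid point
    -- `G a ≤ 1 / K`, and `F n a ≥ 0` suffices.
    · by_cases hc : ⌈K * G a⌉₊ ≤ 1
      · have : G a ≤ 1 / K := by
          rw [le_div_iff₀ hK0, mul_comm]
          simpa using Nat.ceil_le.1 hc
        have := hF0 n a
        have : 0 < 1 / (K : ℝ) := by positivity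
        linarith
      · obtain ⟨j, hj⟩ : ∃ j, ⌈K * G a⌉₊ = j + 1 := ⟨⌈K * G a⌉₊ - 1, by omega⟩
        have hj1 : (j : ℝ) < K * G a := by
          have := Nat.ceil_lt_add_one hKG
          rw [hj] at this
          push_cast at this
          linarith
        have hj2 : K * G a ≤ j + 1 := by
          have := Nat.le_ceil (K * G a)
          rw [hj] at this
          exact_mod_cast this
        have hjK : j < K := by
          have : (j : ℝ) < K := hj1.trans_le (mul_le_of_le_one_right hK0.le (hGl a))
          exact_mod_cast this
        have hxj := hx j (by omega) hjK
        have hlt : G (x j) < G a := by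
          rw [hxj, div_lt_iff₀ hK0]
          linarith
        have h1 := hF n (hG.reflect_lt hlt).le
        have h2 := (abs_lt.1 (hn j (Finset.mem_range.2 hjK))).1
        have h3 : G a ≤ j / K + 1 / K := by
          rw [← add_div, le_div_iff₀ hK0]
          linarith
        rw [hxj] at h2
        linarith
    -- Symmetrically, the floor plus one gives a grid point strictly to the right; without one, `G a
    -- ≥ 1 - 1 / K` and `F n a ≤ 1` suffices.
    · by_cases hc : K ≤ ⌊K * G a⌋₊ + 1
      · have h1 : (K : ℝ) ≤ K * G a + 1 := by
          have h2 := Nat.floor_le hKG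
          have h3 : (K : ℝ) ≤ ⌊K * G a⌋₊ + 1 := by exact_mod_cast hc
          linarith
        have h2 : 1 ≤ G a + 1 / K := by
          have : G a + 1 / K = (K * G a + 1) / K := by field_simp
          rw [this, le_div_iff₀ hK0]
          linarith
        have := hF1 n a
        have : 0 < 1 / (K : ℝ) := by positivity
        linarith
      · have hlt' := Nat.lt_floor_add_one (K * G a)
        have hfl := Nat.floor_le hKG
        set j := ⌊K * G a⌋₊
        have hxj := hx (j + 1) (by omega) (by omega)
        push_cast at hxj
        have hlt : G a < G (x (j + 1)) := by
          rw [hxj, lt_div_iff₀ hK0]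
          linarith
        have h1 := hF n (hG.reflect_lt hlt).le
        have h2 := (abs_lt.1 (hn (j + 1) (Finset.mem_range.2 (by omega)))).2
        have h3 : ((j : ℝ) + 1) / K ≤ G a + 1 / K := by
          have : G a + 1 / K = (K * G a + 1) / K := by field_simp
          rw [this]
          gcongr
        rw [hxj] at h2
        linarith
  obtain ⟨N, hN⟩ := eventually_atTop.1 key
  refine ⟨N, fun n hn => ?_⟩
  rw [Real.dist_0_eq_abs, abs_of_nonneg (Real.iSup_nonneg fun _ => abs_nonneg _)]
  exact (Real.iSup_le (hN n hn.le) (by positivity)).trans_lt hKε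

/-- The jump of a distribution function at a point is the mass of that point. -/
lemma continuous_cdf (μ : Measure ℝ) [IsProbabilityMeasure μ] [NullSingletonClass μ] :
    Continuous (cdf μ) := by
  rw [continuous_iff_continuousAt]
  intro x
  rw [(monotone_cdf μ).continuousAt_iff_leftLim_eq_rightLim, (cdf μ).rightLim_eq]
  have h1 := (cdf μ).measure_singleton x
  rw [measure_cdf, measure_singleton] at h1
  have h2 : cdf μ x - Function.leftLim (cdf μ) x ≤ 0 := by
    rw [← ENNReal.ofReal_eq_zero]
    exact h1.symm
  have h3 := (monotone_cdf μ).leftLim_le (le_refl x)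
  linarith

/-- The frontier of a half-line is a null point, so the portmanteau theorem gives the pointwise
convergence that Pólya's theorem needs. -/
theorem tendsto_iSup_abs_measureReal_Iic_sub {μs : ℕ → ProbabilityMeasure ℝ}
    {μ : ProbabilityMeasure ℝ} [NullSingletonClass (μ : Measure ℝ)] (h : Tendsto μs atTop (𝓝 μ)) :
    Tendsto (fun n => ⨆ a, |(μs n : Measure ℝ).real (Set.Iic a) -
      (μ : Measure ℝ).real (Set.Iic a)|) atTop (𝓝 0) := by
  simp only [← cdf_eq_real]
  refine tendsto_iSup_abs_sub_of_monotone (fun n => monotone_cdf _) (fun n => cdf_nonneg _)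
    (fun n => cdf_le_one _) (monotone_cdf _) (continuous_cdf _) (tendsto_cdf_atBot _)
    (tendsto_cdf_atTop _) fun x => ?_
  simp only [cdf_eq_real]
  have := ProbabilityMeasure.tendsto_measure_of_null_frontier_of_tendsto' h (E := Set.Iic x)
    (by rw [frontier_Iic]; exact measure_singleton x)
  exact (ENNReal.tendsto_toReal (measure_ne_top _ _)).comp this

lemma gaussianReal_real_Iic (a : ℝ) :
    (gaussianReal 0 1).real (Set.Iic a) =
      ∫ t in Set.Iic a, (1 / √(2 * Real.pi)) * Real.exp (-t ^ 2 / 2) := by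
  rw [measureReal_def, gaussianReal_apply_eq_integral 0 one_ne_zero,
    ENNReal.toReal_ofReal (integral_nonneg fun x => gaussianPDFReal_nonneg _ _ _)]
  simp [gaussianPDFReal]

/-! ### Moments of linear combinations of the attaching indicators. -/

section Choice

variable {Ω : Type*} {u : ℕ → Ω → Fin 8}

/-- The linear combination of the indicators `Z_k^i` with coefficients `α i`. -/
def combZ (u : ℕ → Ω → Fin 8) (α : Fin 4 → ℝ) (k : ℕ) (ω : Ω) : ℝ := ∑ i, α i * choiceZ u k i ω

lemma combU_eq_combZ (k : ℕ) : combU u k = combZ u ![648, 972, 1296, 1620] k := by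
  funext ω
  simp [combU, combZ, Fin.sum_univ_four]

lemma combV_eq_combZ (k : ℕ) : combV u k = combZ u ![90, 414, 738, 1062] k := by
  funext ω
  simp [combV, combZ, Fin.sum_univ_four]

/-- The four ways are sorted by distance from `x_1`. The label 0 lies in no `attachSet`, and both
sides vanish there. -/
lemma octDist_zero_eq_sum (a : Fin 8) :
    octDist 0 a = ∑ i : Fin 4, (i.val + 1) * if a ∈ attachSet i then 1 else 0 := by
  revert a
  decide

lemma octDist_eq_combZ (k : ℕ) (ω : Ω) :
    (octDist 0 (u k ω) : ℝ) = combZ u (fun i => (i.val : ℝ) + 1) k ω := by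
  rw [octDist_zero_eq_sum]
  push_cast
  rfl

lemma eq_of_mem_attachSet {a : Fin 8} {i j : Fin 4} (hi : a ∈ attachSet i)
    (hj : a ∈ attachSet j) : i = j := by
  revert a i j
  decide

lemma choiceZ_mul_choiceZ (k : ℕ) (i j : Fin 4) (ω : Ω) :
    choiceZ u k i ω * choiceZ u k j ω = if i = j then choiceZ u k i ω else 0 := by
  unfold choiceZ
  by_cases hi : u k ω ∈ attachSet i <;> by_cases hj : u k ω ∈ attachSet j
  · simp [eq_of_mem_attachSet hi hj]
  · have : i ≠ j := by
      rintro rfl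
      exact hj hi
    simp [hj, this]
  · simp [hi]
  · simp [hi]

/-- The sets `attachSet i` are disjoint, so the indicators are orthogonal idempotents. Second
moments thereby become first moments, which `hprob` supplies. -/
lemma combZ_mul_combZ (α β : Fin 4 → ℝ) (k : ℕ) (ω : Ω) :
    combZ u α k ω * combZ u β k ω = combZ u (fun i => α i * β i) k ω := by
  unfold combZ
  rw [Finset.sum_mul_sum]
  refine Finset.sum_congr rfl fun i _ => ?_
  have : ∀ j, α i * choiceZ u k i ω * (β j * choiceZ u k j ω) =
      if i = j then α i * β j * choiceZ u k i ω else 0 := by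
    intro j
    rw [mul_mul_mul_comm, choiceZ_mul_choiceZ]
    split_ifs <;> simp
  simp [this]

lemma abs_combZ_le (α : Fin 4 → ℝ) (k : ℕ) (ω : Ω) : |combZ u α k ω| ≤ ∑ i, |α i| := by
  refine (Finset.abs_sum_le_sum_abs _ _).trans (Finset.sum_le_sum fun i _ => ?_)
  rw [abs_mul]
  refine mul_le_of_le_one_right (abs_nonneg _) ?_
  unfold choiceZ
  split_ifs <;> simp

variable [MeasurableSpace Ω] {P : Measure Ω} {k : ℕ}

lemma integral_choiceZ {i : Fin 4} (hmeas : Measurable (choiceZ u k i)) :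
    ∫ ω, choiceZ u k i ω ∂P = P.real {ω | choiceZ u k i ω = 1} := by
  have hset : MeasurableSet {ω | choiceZ u k i ω = 1} := hmeas (measurableSet_singleton 1)
  rw [← integral_indicator_one hset]
  congr 1
  funext ω
  by_cases h : u k ω ∈ attachSet i <;> simp [Set.indicator, choiceZ, h]

variable [IsProbabilityMeasure P]

lemma measurable_combZ (hmeas : ∀ i, Measurable (choiceZ u k i)) (α : Fin 4 → ℝ) :
    Measurable (combZ u α k) :=
  Finset.measurable_fun_sum _ fun i _ => (hmeas i).const_mul _

lemma memLp_combZ (hmeas : ∀ i, Measurable (choiceZ u k i)) (α : Fin 4 → ℝ) :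
    MemLp (combZ u α k) 2 P :=
  MemLp.of_bound (measurable_combZ hmeas α).aestronglyMeasurable _
    (ae_of_all _ (abs_combZ_le α k))

variable {p : Fin 4 → ℝ}

lemma integral_combZ (hmeas : ∀ i, Measurable (choiceZ u k i))
    (hprob : ∀ i, P.real {ω | choiceZ u k i ω = 1} = p i) (α : Fin 4 → ℝ) :
    ∫ ω, combZ u α k ω ∂P = ∑ i, α i * p i := by
  unfold combZ
  rw [integral_finsetSum]
  · refine Finset.sum_congr rfl fun i _ => ?_
    rw [integral_const_mul, integral_choiceZ (hmeas i), hprob]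
  · intro i _
    refine Integrable.const_mul (Integrable.of_bound (hmeas i).aestronglyMeasurable 1
      (ae_of_all _ fun ω => ?_)) _
    unfold choiceZ
    split_ifs <;> simp

lemma covariance_combZ (hmeas : ∀ i, Measurable (choiceZ u k i))
    (hprob : ∀ i, P.real {ω | choiceZ u k i ω = 1} = p i) (α β : Fin 4 → ℝ) :
    cov[combZ u α k, combZ u β k; P] =
      ∑ i, α i * β i * p i - (∑ i, α i * p i) * ∑ i, β i * p i := by
  have hmul : combZ u α k * combZ u β k = combZ u (fun i => α i * β i) k :=
    funext fun ω => combZ_mul_combZ α β k ω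
  rw [covariance_eq_sub (memLp_combZ hmeas α) (memLp_combZ hmeas β), hmul]
  simp only [integral_combZ hmeas hprob]

lemma variance_combZ (hmeas : ∀ i, Measurable (choiceZ u k i))
    (hprob : ∀ i, P.real {ω | choiceZ u k i ω = 1} = p i) (α : Fin 4 → ℝ) :
    Var[combZ u α k; P] = ∑ i, α i * α i * p i - (∑ i, α i * p i) * ∑ i, α i * p i := by
  rw [← covariance_self (measurable_combZ hmeas α).aemeasurable, covariance_combZ hmeas hprob]

end Choice

/-! ### Variance and asymptotic normality of the Gutman index. -/

/-- The parameter `x` is kept apart from the upper limit `m`: with `x = m` the summands would change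
in the induction step. -/
lemma sum_sq_mul_sub_sq (x : ℝ) (m : ℕ) :
    ∑ k ∈ Finset.range m, (((k : ℝ) + 1) * (x - 1 - k)) ^ 2 =
      x ^ 2 * (m * (m + 1) * (2 * m + 1) / 6) - 2 * x * (m * (m + 1) / 2) ^ 2
        + m * (m + 1) * (2 * m + 1) * (3 * m ^ 2 + 3 * m - 1) / 30 := by
  induction m with
  | zero => simp
  | succ m ih =>
    rw [Finset.sum_range_succ, ih]
    push_cast
    ring

lemma sum_sq_mul_sub_sq_self (N : ℕ) :
    ∑ k ∈ Finset.range N, (((k : ℝ) + 1) * (N - 1 - k)) ^ 2 = ((N : ℝ) ^ 5 - N) / 30 := by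
  rw [sum_sq_mul_sub_sq]
  ring

section Gutman

variable {Ω : Type*} {u : ℕ → Ω → Fin 8}

/-- The distance between the vertices `x_1` and `u_{k+2}` of the octagon `O_{k+2}`. -/
def innerDist (u : ℕ → Ω → Fin 8) (k : ℕ) : Ω → ℝ :=
  combZ u (fun i => (i.val : ℝ) + 1) (k + 2)

lemma gutCOC_succ (N : ℕ) (ω : Ω) :
    gutCOC u (N + 1) ω = CocGraph.gutConst (N + 1) +
      ∑ k ∈ Finset.range N, 324 * ((k + 1) * ((N : ℝ) - 1 - k)) * innerDist u k ω := by
  rw [gutCOC, CocGraph.gutmanIndex_eq, Finset.sum_range_succ', mul_add, Finset.mul_sum]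
  simp only [CocGraph.attachDist, octDist_eq_combZ, innerDist]
  push_cast
  -- The first octagon has weight zero, so `u 1`, about which no measurability is known, disappears.
  rw [zero_mul, zero_mul, mul_zero, add_zero]
  congr 1
  refine Finset.sum_congr rfl fun k _ => ?_
  ring

variable [MeasurableSpace Ω] {P : Measure Ω}

lemma iIndepFun_innerDist
    (hindep : iIndepFun (fun (k : {k : ℕ // 2 ≤ k}) (ω : Ω) (i : Fin 4) => choiceZ u k i ω) P) :
    iIndepFun (innerDist u) P := by
  have hinj : Function.Injective (fun k : ℕ => (⟨k + 2, by omega⟩ : {k : ℕ // 2 ≤ k})) := by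
    intro a b h
    simpa using h
  exact (hindep.precomp hinj).comp
    (fun _ (z : Fin 4 → ℝ) => ∑ i : Fin 4, ((i.val : ℝ) + 1) * z i) (fun _ => by fun_prop)

variable [IsProbabilityMeasure P]

lemma memLp_innerDist (hmeas : ∀ k, 2 ≤ k → ∀ i, Measurable (choiceZ u k i)) (k : ℕ) :
    MemLp (innerDist u k) 2 P :=
  memLp_combZ (hmeas _ (by omega)) _

lemma measurable_innerDist (hmeas : ∀ k, 2 ≤ k → ∀ i, Measurable (choiceZ u k i)) (k : ℕ) :
    Measurable (innerDist u k) :=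
  measurable_combZ (hmeas _ (by omega)) _

lemma memLp_gutCOC (hmeas : ∀ k, 2 ≤ k → ∀ i, Measurable (choiceZ u k i)) (N : ℕ) :
    MemLp (gutCOC u (N + 1)) 2 P := by
  rw [funext (gutCOC_succ N)]
  exact MemLp.add (f := fun _ => CocGraph.gutConst (N + 1)) (memLp_const _)
    (memLp_finsetSum _ fun (k : ℕ) _ =>
      (memLp_innerDist hmeas k).const_mul (324 * ((k + 1) * ((N : ℝ) - 1 - k))))

lemma variance_gutCOC (hmeas : ∀ k, 2 ≤ k → ∀ i, Measurable (choiceZ u k i))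
    (hindep : iIndepFun (fun (k : {k : ℕ // 2 ≤ k}) (ω : Ω) (i : Fin 4) => choiceZ u k i ω) P)
    {v : ℝ} (hv : ∀ k, Var[innerDist u k; P] = v) (N : ℕ) :
    Var[gutCOC u (N + 1); P] = 324 ^ 2 * (v * (((N : ℝ) ^ 5 - N) / 30)) := by
  have hmem : ∀ k, MemLp (fun ω => 324 * ((k + 1) * ((N : ℝ) - 1 - k)) * innerDist u k ω) 2 P :=
    fun k => (memLp_innerDist hmeas k).const_mul _
  have hsum : (fun ω => ∑ k ∈ Finset.range N,
      324 * ((k + 1) * ((N : ℝ) - 1 - k)) * innerDist u k ω) =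
      ∑ k ∈ Finset.range N, fun ω => 324 * ((k + 1) * ((N : ℝ) - 1 - k)) * innerDist u k ω := by
    funext ω
    simp
  rw [funext (gutCOC_succ N), variance_const_add, hsum, IndepFun.variance_sum]
  · simp only [variance_const_mul, hv]
    rw [← Finset.sum_mul, ← sum_sq_mul_sub_sq_self]
    simp only [mul_pow, ← Finset.mul_sum]
    ring
  · exact fun k _ => hmem k
  · intro i _ j _ hij
    exact ((iIndepFun_innerDist hindep).indepFun hij).comp (measurable_const_mul _)
      (measurable_const_mul _)
  · exact (memLp_finsetSum _ fun k _ => hmem k).aestronglyMeasurable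

lemma integral_gutCOC (hmeas : ∀ k, 2 ≤ k → ∀ i, Measurable (choiceZ u k i))
    {m : ℝ} (hm : ∀ k, ∫ ω, innerDist u k ω ∂P = m) (N : ℕ) :
    ∫ ω, gutCOC u (N + 1) ω ∂P = CocGraph.gutConst (N + 1) +
      ∑ k ∈ Finset.range N, 324 * ((k + 1) * ((N : ℝ) - 1 - k)) * m := by
  have hint : ∀ k : ℕ,
      Integrable (fun ω => 324 * ((k + 1) * ((N : ℝ) - 1 - k)) * innerDist u k ω) P :=
    fun k => ((memLp_innerDist hmeas k).integrable one_le_two).const_mul _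
  simp only [gutCOC_succ]
  rw [integral_add (integrable_const _) (integrable_finsetSum _ fun k _ => hint k),
    integral_finsetSum _ fun k _ => hint k]
  simp [integral_const_mul, hm]

/-- The coefficients of the centered distances in the standardized Gutman index. -/
noncomputable def stdWeight (v : ℝ) (N k : ℕ) : ℝ :=
  (k + 1) * ((N : ℝ) - 1 - k) / √(v * (((N : ℝ) ^ 5 - N) / 30))

/-- The deterministic part cancels on centering, and the factor 324 cancels against the standard
deviation. -/
lemma standardized_gutCOC (hmeas : ∀ k, 2 ≤ k → ∀ i, Measurable (choiceZ u k i))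
    (hindep : iIndepFun (fun (k : {k : ℕ // 2 ≤ k}) (ω : Ω) (i : Fin 4) => choiceZ u k i ω) P)
    {v m : ℝ} (hv : ∀ k, Var[innerDist u k; P] = v) (hm : ∀ k, ∫ ω, innerDist u k ω ∂P = m)
    (N : ℕ) (ω : Ω) :
    (gutCOC u (N + 1) ω - ∫ ω', gutCOC u (N + 1) ω' ∂P) / √(Var[gutCOC u (N + 1); P]) =
      ∑ k ∈ Finset.range N, stdWeight v N k * (innerDist u k ω - m) := by
  rw [integral_gutCOC hmeas hm, variance_gutCOC hmeas hindep hv, gutCOC_succ,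
    Real.sqrt_mul (by positivity), Real.sqrt_sq (by norm_num), add_sub_add_left_eq_sub,
    ← Finset.sum_sub_distrib]
  have : ∀ k : ℕ, 324 * ((k + 1) * ((N : ℝ) - 1 - k)) * innerDist u k ω -
      324 * ((k + 1) * ((N : ℝ) - 1 - k)) * m =
      324 * ((k + 1) * ((N : ℝ) - 1 - k) * (innerDist u k ω - m)) := fun k => by ring
  simp only [this]
  rw [← Finset.mul_sum, mul_div_mul_left _ _ (by norm_num), Finset.sum_div]
  refine Finset.sum_congr rfl fun k _ => ?_
  rw [stdWeight]
  ring

lemma two_mul_le_pow_five {x : ℝ} (hx : 2 ≤ x) : 2 * x ≤ x ^ 5 := by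
  have : (2 : ℝ) ^ 4 ≤ x ^ 4 := by gcongr
  nlinarith

/-- The squared numerator is at most `N⁴`, and `N⁵ - N ≥ N⁵ / 2` for `N ≥ 2`; together with the 30
in the variance this gives the 60. -/
lemma abs_stdWeight_le {v : ℝ} (hv : 0 < v) (N k : ℕ) (hk : k < N) :
    |stdWeight v N k| ≤ √(60 / v / N) := by
  -- For `N = 1` the variance is zero, but so is the only weight.
  rcases (show 1 ≤ N by omega).eq_or_lt with rfl | hN
  · obtain rfl : k = 0 := by omega
    simp [stdWeight]
    positivity
  have hN2 : (2 : ℝ) ≤ N := by exact_mod_cast hN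
  have hk' : (k : ℝ) + 1 ≤ N := by exact_mod_cast hk
  have hk0 : (0 : ℝ) ≤ k := Nat.cast_nonneg k
  have h5 := two_mul_le_pow_five hN2
  have hw : 0 < v * (((N : ℝ) ^ 5 - N) / 30) := mul_pos hv (by linarith)
  apply Real.abs_le_sqrt
  rw [stdWeight, div_pow, Real.sq_sqrt hw.le, div_div, div_le_div_iff₀ hw (by positivity)]
  have h1 : ((k + 1) * ((N : ℝ) - 1 - k)) ^ 2 ≤ (N * N) ^ 2 := by
    have h2 : 0 ≤ (N : ℝ) - 1 - k := by linarith
    gcongr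
    linarith
  calc ((k + 1) * ((N : ℝ) - 1 - k)) ^ 2 * (v * N) ≤ (N * N) ^ 2 * (v * N) := by gcongr
    _ = v * (N : ℝ) ^ 5 := by ring
    _ ≤ v * (2 * ((N : ℝ) ^ 5 - N)) := by
        gcongr
        linarith
    _ = _ := by ring

lemma sum_stdWeight_sq {v : ℝ} (hv : 0 < v) {N : ℕ} (hN : 2 ≤ N) :
    v * ∑ k ∈ Finset.range N, stdWeight v N k ^ 2 = 1 := by
  have hN2 : (2 : ℝ) ≤ N := by exact_mod_cast hN
  have h5 := two_mul_le_pow_five hN2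
  have hw : 0 < v * (((N : ℝ) ^ 5 - N) / 30) := mul_pos hv (by linarith)
  simp only [stdWeight, div_pow, Real.sq_sqrt hw.le]
  rw [← Finset.sum_div, sum_sq_mul_sub_sq_self, mul_div_assoc', div_self hw.ne']

theorem tendsto_iSup_cdf_gutCOC (hmeas : ∀ k, 2 ≤ k → ∀ i, Measurable (choiceZ u k i))
    (hindep : iIndepFun (fun (k : {k : ℕ // 2 ≤ k}) (ω : Ω) (i : Fin 4) => choiceZ u k i ω) P)
    {v m : ℝ} (hv0 : 0 < v) (hv : ∀ k, Var[innerDist u k; P] = v)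
    (hm : ∀ k, ∫ ω, innerDist u k ω ∂P = m) :
    Tendsto
      (fun n : ℕ => ⨆ a : ℝ,
        |P.real {ω | (gutCOC u n ω - ∫ ω', gutCOC u n ω' ∂P) / √(Var[gutCOC u n; P]) ≤ a}
          - ∫ t in Set.Iic a, (1 / √(2 * Real.pi)) * Real.exp (-t ^ 2 / 2)|)
      atTop (𝓝 0) := by
  -- The index becomes `N + 1`, which drops the empty chain.
  rw [← tendsto_add_atTop_iff_nat 1]
  simp only [standardized_gutCOC hmeas hindep hv hm, ← gaussianReal_real_Iic]
  have hX : ∀ k, Measurable fun ω => innerDist u k ω - m := fun k =>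
    (measurable_innerDist hmeas k).sub_const m
  have hS : ∀ N, Measurable fun ω => ∑ k ∈ Finset.range N,
      stdWeight v N k * (innerDist u k ω - m) := fun N =>
    Finset.measurable_fun_sum _ fun k _ => (hX k).const_mul _
  have hlim := tendsto_charFun_weighted_sum (P := P) (X := fun k ω => innerDist u k ω - m)
    (M := ∑ i : Fin 4, |(i.val : ℝ) + 1| + |m|) (v := v) (b := stdWeight v)
    (B := fun N => √(60 / v / N))
    ((iIndepFun_innerDist hindep).comp (fun _ x => x - m) fun _ => by fun_prop) hX
    (fun k ω => (abs_sub _ _).trans (by gcongr; exact abs_combZ_le _ _ _))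
    (fun k => by
      rw [integral_sub ((memLp_innerDist hmeas k).integrable one_le_two) (integrable_const _), hm]
      simp)
    (fun k => by
      rw [← hv k, variance_eq_integral (measurable_innerDist hmeas k).aemeasurable, hm])
    (fun N k hk => abs_stdWeight_le hv0 N k hk)
    (by
      have := (tendsto_const_div_atTop_nhds_zero_nat (60 / v)).sqrt
      simpa using this)
    ((eventually_ge_atTop 2).mono fun N hN => sum_stdWeight_sq hv0 hN)
  let μs : ℕ → ProbabilityMeasure ℝ := fun N =>
    ⟨P.map fun ω => ∑ k ∈ Finset.range N, stdWeight v N k * (innerDist u k ω - m),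
      Measure.isProbabilityMeasure_map (hS N).aemeasurable⟩
  let μ : ProbabilityMeasure ℝ := ⟨gaussianReal 0 1, inferInstance⟩
  have hμ : Tendsto μs atTop (𝓝 μ) := by
    refine ProbabilityMeasure.tendsto_of_tendsto_charFun fun t => ?_
    have h1 : charFun (μ : Measure ℝ) t = (Real.exp (-(t ^ 2 / 2)) : ℝ) := by
      change charFun (gaussianReal 0 1) t = _
      rw [charFun_gaussianReal]
      simp
    rw [h1]
    exact hlim t
  have : NullSingletonClass (μ : Measure ℝ) := nullSingletonClass_gaussianReal one_ne_zero
  have hfin := tendsto_iSup_abs_measureReal_Iic_sub hμ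
  have hreal : ∀ N a, (μs N : Measure ℝ).real (Set.Iic a) =
      P.real {ω | ∑ k ∈ Finset.range N, stdWeight v N k * (innerDist u k ω - m) ≤ a} := by
    intro N a
    exact map_measureReal_apply (hS N) measurableSet_Iic
  simp only [hreal] at hfin
  exact hfin

end Gutman

/-- This is the variance of the law with mass `pᵢ` at `i`, and it equals the sum of `(i - j)² pᵢ pⱼ`
over `i < j`. -/
lemma variance_innerDist_pos {p₁ p₂ p₃ p₄ : ℝ} (h₁ : 0 < p₁) (h₂ : 0 < p₂) (h₃ : 0 < p₃)
    (h₄ : 0 < p₄) (h : p₁ + p₂ + p₃ + p₄ = 1) :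
    0 < p₁ + 4 * p₂ + 9 * p₃ + 16 * p₄ - (p₁ + 2 * p₂ + 3 * p₃ + 4 * p₄) ^ 2 := by
  have : p₁ + 4 * p₂ + 9 * p₃ + 16 * p₄ - (p₁ + 2 * p₂ + 3 * p₃ + 4 * p₄) ^ 2 =
      p₁ * p₂ + 4 * (p₁ * p₃) + 9 * (p₁ * p₄) + p₂ * p₃ + 4 * (p₂ * p₄) + p₃ * p₄ := by
    obtain rfl : p₄ = 1 - p₁ - p₂ - p₃ := by linarith
    ring
  rw [this]
  positivity

theorem theorem3p1 {Ω : Type*} [MeasurableSpace Ω] (P : Measure Ω) [IsProbabilityMeasure P]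
    (p₁ p₂ p₃ : ℝ)
    (hp₁ : 0 < p₁ ∧ p₁ < 1) (hp₂ : 0 < p₂ ∧ p₂ < 1) (hp₃ : 0 < p₃ ∧ p₃ < 1)
    (hp₄ : 0 < 1 - p₁ - p₂ - p₃ ∧ 1 - p₁ - p₂ - p₃ < 1)
    -- `u k ω` is the vertex of the octagon `O_k` to which `O_{k+1}` is attached;
    -- for `k ≥ 2` it is not the vertex `x_1`, which already carries the edge to `O_{k-1}`
    (u : ℕ → Ω → Fin 8)
    (hu : ∀ k, 2 ≤ k → ∀ ω, u k ω ≠ 0)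
    (hmeas : ∀ k, 2 ≤ k → ∀ i, Measurable (choiceZ u k i))
    (hprob : ∀ k, 2 ≤ k → ∀ i,
      P.real {ω | choiceZ u k i ω = 1} = ![p₁, p₂, p₃, 1 - p₁ - p₂ - p₃] i)
    (hindep : iIndepFun (fun (k : {k : ℕ // 2 ≤ k}) (ω : Ω) (i : Fin 4) => choiceZ u k i ω) P) :
    (∀ k, 2 ≤ k →
      Var[combU u k; P] = sigmaSq p₁ p₂ p₃ ∧
      Var[combV u k; P] = sigmaTildeSq p₁ p₂ p₃ ∧
      cov[combU u k, combV u k; P] = covR p₁ p₂ p₃) ∧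
    (∀ n : ℕ, 1 ≤ n →
      MemLp (gutCOC u n) 2 P ∧
      Var[gutCOC u n; P] =
        (1 / 30) * (sigmaSq p₁ p₂ p₃ * (n : ℝ) ^ 5 - 5 * covR p₁ p₂ p₃ * (n : ℝ) ^ 4
          + 10 * sigmaTildeSq p₁ p₂ p₃ * (n : ℝ) ^ 3
          + (65 * covR p₁ p₂ p₃ - 30 * sigmaSq p₁ p₂ p₃ - 45 * sigmaTildeSq p₁ p₂ p₃)
              * (n : ℝ) ^ 2
          + (59 * sigmaSq p₁ p₂ p₃ + 65 * sigmaTildeSq p₁ p₂ p₃ - 120 * covR p₁ p₂ p₃) * (n : ℝ)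
          + (60 * covR p₁ p₂ p₃ - 30 * sigmaSq p₁ p₂ p₃ - 30 * sigmaTildeSq p₁ p₂ p₃))) ∧
    Tendsto
      (fun n : ℕ => ⨆ a : ℝ,
        |P.real {ω | (gutCOC u n ω - ∫ ω', gutCOC u n ω' ∂P) / √(Var[gutCOC u n; P]) ≤ a}
          - ∫ t in Set.Iic a, (1 / √(2 * Real.pi)) * Real.exp (-t ^ 2 / 2)|)
      atTop (𝓝 0) := by
  set v : ℝ := p₁ + 4 * p₂ + 9 * p₃ + 16 * (1 - p₁ - p₂ - p₃)
    - (p₁ + 2 * p₂ + 3 * p₃ + 4 * (1 - p₁ - p₂ - p₃)) ^ 2 with hvdef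
  have hv0 : 0 < v := variance_innerDist_pos hp₁.1 hp₂.1 hp₃.1 hp₄.1 (by ring)
  have hv : ∀ k, Var[innerDist u k; P] = v := by
    intro k
    rw [innerDist, variance_combZ (hmeas _ (by omega)) (hprob _ (by omega))]
    simp [Fin.sum_univ_four, hvdef]
    ring
  refine ⟨fun k hk => ⟨?_, ?_, ?_⟩, fun n hn => ?_,
    tendsto_iSup_cdf_gutCOC hmeas hindep hv0 hv fun k =>
      integral_combZ (hmeas _ (by omega)) (hprob _ (by omega)) _⟩
  · rw [combU_eq_combZ, variance_combZ (hmeas k hk) (hprob k hk)]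
    simp [Fin.sum_univ_four, sigmaSq]
    ring
  · rw [combV_eq_combZ, variance_combZ (hmeas k hk) (hprob k hk)]
    simp [Fin.sum_univ_four, sigmaTildeSq]
    ring
  · rw [combU_eq_combZ, combV_eq_combZ, covariance_combZ (hmeas k hk) (hprob k hk)]
    simp [Fin.sum_univ_four, covR]
    ring
  · obtain ⟨N, rfl⟩ : ∃ N, n = N + 1 := ⟨n - 1, by omega⟩
    refine ⟨memLp_gutCOC hmeas N, ?_⟩
    -- The coefficients of `U_k` are `324 (i + 1)` and those of `V_k` are `324 i - 234` for the ways
    -- `i = 1, …, 4`. As the probabilities sum to one, the additive constants affect neither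
    -- variances nor the covariance.
    have hσ : sigmaSq p₁ p₂ p₃ = 324 ^ 2 * v := by
      rw [hvdef, sigmaSq]
      ring
    have hσ' : sigmaTildeSq p₁ p₂ p₃ = 324 ^ 2 * v := by
      rw [hvdef, sigmaTildeSq]
      ring
    have hr : covR p₁ p₂ p₃ = 324 ^ 2 * v := by
      rw [hvdef, covR]
      ring
    -- With the three constants equal, the quintic collapses to `(n - 1)⁵ - (n - 1)`.
    rw [variance_gutCOC hmeas hindep hv, hσ, hσ', hr]
    push_cast
    ring
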